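/- Let $d\ge 1$ and $\alpha=(\alpha_1,\dots,\alpha_d)\in(-\tfrac12,\infty)^d$. Let $\mathbb R_+^d=(0,\infty)^d$ carry the Laguerre measure $$d\mu_\alpha(x)=\prod_{i=1}^d\frac{x_i^{\alpha_i}e^{-x_i}}{\Gamma(\alpha_i+1)}\,dx .$$ For $t>0$ and $f\in L^\infty(\mathbb R_+^d,\mu_\alpha)$ (real- or complex-valued) let $$T_t^\alpha f(x)=\int_{\mathbb R_+^d}G_t^\alpha(x,y)f(y)\,d\mu_\alpha(y),$$ $$G_t^\alpha(x,y)=\prod_{j=1}^d\frac{\Gamma(\alpha_j+1)}{1-e^{-t}}\,e^{-\frac{e^{-t}}{1-e^{-t}}(x_j+y_j)}\bigl(\sqrt{e^{-t}x_jy_j}\bigr)^{-\alpha_j}I_{\alpha_j}\!\Bigl(\frac{2\sqrt{e^{-t}x_jy_j}}{1-e^{-t}}\Bigr)$$ be the Laguerre heat semigroup, where $I_\nu(z)=\sum_{k\ge0}\frac{(z/2)^{2k+\nu}}{k!\,\Gamma(k+\nu+1)}$ is the modified Bessel function of the first kind, and let $$P_t^\alpha f(x)=\frac1{\sqrt\pi}\int_0^\infty\frac{e^{-u}}{\sqrt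 u}\,T^\alpha_{t^2/(4u)}f(x)\,du$$ be the Poisson–Laguerre semigroup. For $\beta>0$ let $n$ be the smallest integer greater than $\beta$; the Laguerre Lipschitz space $\mathrm{Lip}_\beta(\mu_\alpha)$ is the set of all $f\in L^\infty(\mathbb R_+^d,\mu_\alpha)$ for which there is a constant $A$ with $$\Bigl\|\frac{\partial^n P_t^\alpha f}{\partial t^n}\Bigr\|_\infty\le A\,t^{-n+\beta}\qquad\text{for all }t>0 .$$ If $0<\beta_1<\beta_2$, then $\mathrm{Lip}_{\beta_2}(\mu_\alpha)\subseteq \mathrm{Lip}_{\beta_1}(\mu_\alpha)$. -/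

import Mathlib

open MeasureTheory
open scoped ENNReal NNReal

namespace Laguerre

/-- The open positive orthant `(0, ∞)^d`. -/
def orthant (d : ℕ) : Set (Fin d → ℝ) := {x | ∀ i, 0 < x i}

/-- The Laguerre probability measure of type `α`: the measure carried by `(0, ∞)^d` with Lebesgue
density `∏ i, x i ^ α i * exp (-x i) / Γ(α i + 1)`. -/
noncomputable def laguerreMeasure {d : ℕ} (α : Fin d → ℝ) : Measure (Fin d → ℝ) :=
  (volume.restrict (orthant d)).withDensity fun x =>
    ENNReal.ofReal (∏ i, x i ^ α i * Real.exp (-x i) / Real.Gamma (α i + 1))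

/-- The modified Bessel function of the first kind and order `ν`, on `(0, ∞)`, by its power series
`∑ k, (z / 2)^(2 k + ν) / (k! Γ(k + ν + 1))` (convergent for all `z > 0`). -/
noncomputable def besselI (ν z : ℝ) : ℝ :=
  ∑' k : ℕ, (z / 2) ^ (2 * (k : ℝ) + ν) /
    ((k.factorial : ℝ) * Real.Gamma ((k : ℝ) + ν + 1))

/-- The Laguerre heat kernel with respect to the Laguerre measure, for `t > 0` and `x`, `y` in the
positive orthant. -/
noncomputable def heatKernel {d : ℕ} (α : Fin d → ℝ) (t : ℝ) (x y : Fin d → ℝ) : ℝ :=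
  ∏ j, Real.Gamma (α j + 1) / (1 - Real.exp (-t)) *
    Real.exp (-(Real.exp (-t) / (1 - Real.exp (-t))) * (x j + y j)) *
    Real.sqrt (Real.exp (-t) * x j * y j) ^ (-α j) *
    besselI (α j) (2 * Real.sqrt (Real.exp (-t) * x j * y j) / (1 - Real.exp (-t)))

/-- The Laguerre heat semigroup: integration against the heat kernel for `t > 0`, and the identity
at `t = 0` (negative times are not used). -/
noncomputable def heatSemigroup {𝕜 : Type*} [RCLike 𝕜] {d : ℕ} (α : Fin d → ℝ) (t : ℝ)
    (f : (Fin d → ℝ) → 𝕜) (x : Fin d → ℝ) : 𝕜 :=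
  if 0 < t then ∫ y, heatKernel α t x y • f y ∂(laguerreMeasure α) else f x

/-- The Poisson-Laguerre semigroup, subordinated to the Laguerre heat semigroup:
`P_t f(x) = π^(-1/2) ∫_0^∞ exp(-u) u^(-1/2) T_{t² / (4 u)} f(x) du`. -/
noncomputable def poissonSemigroup {𝕜 : Type*} [RCLike 𝕜] {d : ℕ} (α : Fin d → ℝ) (t : ℝ)
    (f : (Fin d → ℝ) → 𝕜) (x : Fin d → ℝ) : 𝕜 :=
  (1 / Real.sqrt Real.pi) • ∫ u in Set.Ioi (0 : ℝ),
    (Real.exp (-u) / Real.sqrt u) • heatSemigroup α (t ^ 2 / (4 * u)) f x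

/-- The smallest natural number strictly greater than `β` (for `β ≥ 0`). -/
noncomputable def order (β : ℝ) : ℕ := ⌊β⌋₊ + 1

theorem order_isLeast {β : ℝ} (hβ : 0 ≤ β) : IsLeast {n : ℕ | β < n} (order β) := by
  refine ⟨?_, fun n hn => ?_⟩
  · simpa [order] using Nat.lt_floor_add_one β
  · exact Nat.succ_le_of_lt ((Nat.floor_lt hβ).2 hn)

/-- The Laguerre Lipschitz space `Lip_β(μ_α)`: the (classes of) functions `f ∈ L^∞(μ_α)` for which,
with `n` the smallest integer greater than `β`, there is a constant `A` such that
`‖∂ⁿ P_t f / ∂tⁿ‖_∞ ≤ A t^(-n + β)` for all `t > 0`. The sup norm is the essential supremum over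
the positive orthant. -/
def Lip (𝕜 : Type*) [RCLike 𝕜] {d : ℕ} (α : Fin d → ℝ) (β : ℝ) :
    Set (Lp 𝕜 ∞ (laguerreMeasure α)) :=
  {f | ∃ A : ℝ≥0, ∀ t : ℝ, 0 < t →
    eLpNorm (fun x => iteratedDeriv (order β) (fun s => poissonSemigroup α s (f : _ → 𝕜) x) t)
      ∞ (laguerreMeasure α) ≤ ENNReal.ofReal (A * t ^ (-(order β : ℝ) + β))}

end Laguerre

/-!
For every fixed `x` in the orthant the function `φ(t) = P_t f(x)` is smooth on `(0, ∞)` and satisfies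
`|φ⁽ⁿ⁾(t)| ≤ C t^(-n) ‖f‖_∞`, with `C` depending on `n` only; everything else is calculus in `t`.

*The smoothing estimate.* Expanding the Bessel function and integrating term by term shows that the
heat kernel has mass at most one (`lintegral_heatKernel₁_mul_density_le`: the terms are Poisson
weights), so `w ↦ T_{1/w} f(x)` is bounded by `‖f‖_∞`. The substitution `u = t² w / 4` turns the
subordination integral into a multiple of `t ∫ w^(-1/2) exp(-t² w / 4) T_{1/w} f(x) dw`, where `t`
occurs only in the kernel (`poissonSemigroup_eq`). The integrals
`t^i ∫ w^(j - 1/2) exp(-t² w / 4) g(w) dw` form a family stable under differentiation, and a Gamma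
integral bounds each of them by the power of `t` that homogeneity dictates
(`exists_norm_iteratedDeriv_le`).

*The inclusion.* Let `n₁ ≤ n₂` be the orders of `β₁ < β₂`. The hypothesis for `t ≤ 1` and the
smoothing estimate for `t ≥ 1` bound the `n₂`-th derivative by `B t^(-n₂ + β₁)` for all `t > 0`
(`le_mul_rpow_of_le_of_le`). As the derivatives of `φ` vanish at infinity and
`β₁ < n₁ ≤ k` for `n₁ ≤ k < n₂`, integrating over `[t, ∞)` lowers the order of the derivative from
`n₂` to `n₁` (`exists_norm_iteratedDeriv_le_of_add`). Here the bound must hold for almost every `x`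
simultaneously in all `t`, which follows by continuity from its validity at rational `t`
(`ae_forall_norm_le_of_forall_eLpNorm_le`).
-/

namespace Laguerre

open Set Filter Topology

/-! ### The heat semigroup is a contraction -/

section Kernel

/-- The one-dimensional Laguerre heat kernel, a factor of `heatKernel`. -/
noncomputable def heatKernel₁ (a t x y : ℝ) : ℝ :=
  Real.Gamma (a + 1) / (1 - Real.exp (-t)) *
    Real.exp (-(Real.exp (-t) / (1 - Real.exp (-t))) * (x + y)) *
    Real.sqrt (Real.exp (-t) * x * y) ^ (-a) *
    besselI a (2 * Real.sqrt (Real.exp (-t) * x * y) / (1 - Real.exp (-t)))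

/-- The one-dimensional Laguerre density, a factor of the density of `laguerreMeasure`. -/
noncomputable def laguerreDensity₁ (a y : ℝ) : ℝ := y ^ a * Real.exp (-y) / Real.Gamma (a + 1)

theorem besselI_term_nonneg {ν z : ℝ} (hν : -1 < ν) (hz : 0 ≤ z) (k : ℕ) :
    0 ≤ (z / 2) ^ (2 * (k : ℝ) + ν) / ((k.factorial : ℝ) * Real.Gamma ((k : ℝ) + ν + 1)) := by
  have : 0 < Real.Gamma ((k : ℝ) + ν + 1) :=
    Real.Gamma_pos_of_pos (by have := k.cast_nonneg (α := ℝ); linarith)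
  positivity

theorem besselI_nonneg {ν z : ℝ} (hν : -1 < ν) (hz : 0 ≤ z) : 0 ≤ besselI ν z :=
  tsum_nonneg (besselI_term_nonneg hν hz)

theorem measurable_besselI (ν : ℝ) : Measurable (besselI ν) :=
  Measurable.tsum fun k => by fun_prop

theorem one_sub_exp_neg_pos {t : ℝ} (ht : 0 < t) : 0 < 1 - Real.exp (-t) := by
  have : Real.exp (-t) < 1 := by simpa using ht
  linarith

theorem heatKernel₁_nonneg {a t x y : ℝ} (ha : -1 < a) (ht : 0 < t) : 0 ≤ heatKernel₁ a t x y := by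
  have h1 := one_sub_exp_neg_pos ht
  have h2 : 0 < Real.Gamma (a + 1) := Real.Gamma_pos_of_pos (by linarith)
  have h3 := besselI_nonneg ha
    (z := 2 * Real.sqrt (Real.exp (-t) * x * y) / (1 - Real.exp (-t))) (by positivity)
  unfold heatKernel₁
  positivity

theorem measurable_heatKernel₁_uncurry (a x : ℝ) :
    Measurable fun p : ℝ × ℝ => heatKernel₁ a p.1 x p.2 := by
  unfold heatKernel₁
  exact Measurable.mul (by fun_prop) ((measurable_besselI a).comp (by fun_prop))

/-- The powers of `y` in the kernel's prefactor and in the Bessel series cancel to integer powers, so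
each term is a Gamma density in `y` up to a constant. -/
theorem heatKernel₁_mul_density {a t x y : ℝ} (ha : -1 < a) (ht : 0 < t) (hx : 0 < x)
    (hy : 0 < y) :
    heatKernel₁ a t x y * laguerreDensity₁ a y = ∑' k : ℕ,
      1 / (1 - Real.exp (-t)) * Real.exp (-(Real.exp (-t) * x / (1 - Real.exp (-t)))) *
        ((Real.exp (-t) * x) ^ k * (1 - Real.exp (-t)) ^ (-(2 * (k : ℝ) + a)) /
          ((k.factorial : ℝ) * Real.Gamma ((k : ℝ) + a + 1))) *
        (y ^ ((k : ℝ) + a) * Real.exp (-(1 / (1 - Real.exp (-t)) * y))) := by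
  have hs := one_sub_exp_neg_pos ht
  have hr := Real.exp_pos (-t)
  rw [heatKernel₁, laguerreDensity₁, besselI, ← tsum_mul_left, ← tsum_mul_right]
  refine tsum_congr fun k => ?_
  -- with `s = 1 - exp (-t)` the exponents combine through `(1 - s) / s + 1 = 1 / s`
  generalize hrd : Real.exp (-t) = r at *
  obtain ⟨s, rfl⟩ : ∃ s, r = 1 - s := ⟨1 - r, by ring⟩
  simp only [sub_sub_cancel] at *
  have hG : 0 < Real.Gamma (a + 1) := Real.Gamma_pos_of_pos (by linarith)
  have hz : 0 < Real.sqrt ((1 - s) * x * y) := by positivity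
  set z := Real.sqrt ((1 - s) * x * y) with hzd
  have e1 : Real.exp (-((1 - s) / s) * (x + y)) * Real.exp (-y) =
      Real.exp (-((1 - s) * x / s)) * Real.exp (-(1 / s * y)) := by
    rw [← Real.exp_add, ← Real.exp_add]
    congr 1
    field_simp
    ring
  have e2 : z ^ (-a) * (2 * z / s / 2) ^ (2 * (k : ℝ) + a) =
      ((1 - s) * x) ^ k * y ^ k * s ^ (-(2 * (k : ℝ) + a)) := by
    rw [show 2 * z / s / 2 = z * s⁻¹ by field_simp, Real.mul_rpow hz.le (by positivity),
      ← mul_assoc, ← Real.rpow_add hz, show -a + (2 * (k : ℝ) + a) = (2 : ℕ) * (k : ℕ) by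
        push_cast; ring, Real.rpow_mul hz.le, Real.rpow_natCast, Real.rpow_natCast, hzd,
      Real.sq_sqrt (by positivity), mul_pow, Real.inv_rpow hs.le, Real.rpow_neg hs.le]
  have e3 : y ^ ((k : ℝ) + a) = y ^ k * y ^ a := by rw [Real.rpow_add hy, Real.rpow_natCast]
  rw [e3]
  calc _ = (Real.Gamma (a + 1) / Real.Gamma (a + 1)) * (1 / s) *
        (Real.exp (-((1 - s) / s) * (x + y)) * Real.exp (-y)) *
        (z ^ (-a) * (2 * z / s / 2) ^ (2 * (k : ℝ) + a)) * y ^ a /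
        ((k.factorial : ℝ) * Real.Gamma ((k : ℝ) + a + 1)) := by ring
    _ = _ := by rw [e1, e2, div_self hG.ne']; ring

/-- The heat kernel has mass at most one (in fact one): integrating the Bessel series term by term
gives the weights of a Poisson distribution. -/
theorem lintegral_heatKernel₁_mul_density_le {a t x : ℝ} (ha : -1 < a) (ht : 0 < t) (hx : 0 < x) :
    ∫⁻ y in Ioi (0 : ℝ), ENNReal.ofReal (heatKernel₁ a t x y * laguerreDensity₁ a y) ≤ 1 := by
  have hs := one_sub_exp_neg_pos ht
  have hr := Real.exp_pos (-t)
  have hka : ∀ k : ℕ, 0 < (k : ℝ) + a + 1 := fun k => by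
    have := k.cast_nonneg (α := ℝ); linarith
  set s := 1 - Real.exp (-t) with hsd
  set r := Real.exp (-t) with hrd
  set c : ℕ → ℝ := fun k => 1 / s * Real.exp (-(r * x / s)) *
        ((r * x) ^ k * s ^ (-(2 * (k : ℝ) + a)) /
          ((k.factorial : ℝ) * Real.Gamma ((k : ℝ) + a + 1))) with hc
  have hc0 : ∀ k, 0 ≤ c k := fun k => by
    have := Real.Gamma_pos_of_pos (hka k)
    positivity
  have h1 : ∀ k : ℕ, ∫⁻ y in Ioi (0 : ℝ),
      ENNReal.ofReal (c k * (y ^ ((k : ℝ) + a) * Real.exp (-(1 / s * y)))) =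
      ENNReal.ofReal (Real.exp (-(r * x / s)) * ((r * x / s) ^ k / k.factorial)) := by
    intro k
    have hint := integrableOn_rpow_mul_exp_neg_mul_rpow (s := (k : ℝ) + a) (p := 1) (b := 1 / s)
      (by linarith [hka k]) one_pos (by positivity)
    simp only [Real.rpow_one, neg_mul] at hint
    rw [← ofReal_integral_eq_lintegral_ofReal (hint.const_mul (c k)), integral_const_mul]
    · have hI := Real.integral_rpow_mul_exp_neg_mul_Ioi (hka k) (r := 1 / s) (by positivity)
      rw [add_sub_cancel_right] at hI
      rw [hI, one_div_one_div]
      congr 1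
      have hΓ := (Real.Gamma_pos_of_pos (hka k)).ne'
      have e : s ^ (-(2 * (k : ℝ) + a)) * s ^ ((k : ℝ) + a + 1) = s / s ^ k := by
        rw [← Real.rpow_add hs, show -(2 * (k : ℝ) + a) + ((k : ℝ) + a + 1) = 1 - k by ring,
          Real.rpow_sub hs, Real.rpow_one, Real.rpow_natCast]
      calc _ = 1 / s * Real.exp (-(r * x / s)) * ((r * x) ^ k / k.factorial) *
            (s ^ (-(2 * (k : ℝ) + a)) * s ^ ((k : ℝ) + a + 1)) *
            (Real.Gamma ((k : ℝ) + a + 1) / Real.Gamma ((k : ℝ) + a + 1)) := by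
            rw [hc]; field_simp
        _ = _ := by rw [e, div_self hΓ, div_pow]; field_simp
    · filter_upwards [ae_restrict_mem measurableSet_Ioi] with y hy
      have hy : 0 < y := hy
      exact mul_nonneg (hc0 k) (by positivity)
  calc _ ≤ ∫⁻ y in Ioi (0 : ℝ), ∑' k : ℕ,
        ENNReal.ofReal (c k * (y ^ ((k : ℝ) + a) * Real.exp (-(1 / s * y)))) := by
        refine setLIntegral_mono' measurableSet_Ioi fun y hy => ?_
        have hy : 0 < y := hy
        rw [heatKernel₁_mul_density ha ht hx hy]
        -- a divergent real series has the junk sum `0`, so the inequality needs no convergence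
        by_cases hsum : Summable fun k => c k * (y ^ ((k : ℝ) + a) * Real.exp (-(1 / s * y)))
        · exact (ENNReal.ofReal_tsum_of_nonneg
            (fun k => mul_nonneg (hc0 k) (by positivity)) hsum).le
        · rw [tsum_eq_zero_of_not_summable hsum]
          simp
    _ = ∑' k : ℕ, ENNReal.ofReal (Real.exp (-(r * x / s)) * ((r * x / s) ^ k / k.factorial)) := by
        rw [lintegral_tsum fun k => by fun_prop]
        exact tsum_congr h1
    _ = 1 := by
        have hsum := (Real.summable_pow_div_factorial (r * x / s)).mul_left
          (Real.exp (-(r * x / s)))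
        rw [← ENNReal.ofReal_tsum_of_nonneg (fun k => by positivity) hsum, tsum_mul_left,
          ← congrFun (NormedSpace.exp_eq_tsum_div (𝔸 := ℝ)) _, ← Real.exp_eq_exp_ℝ,
          ← Real.exp_add]
        simp

theorem measurableSet_orthant (d : ℕ) : MeasurableSet (orthant d) := by
  have : orthant d = Set.univ.pi fun _ => Ioi 0 := by ext; simp [orthant]
  rw [this]
  exact MeasurableSet.univ_pi fun _ => measurableSet_Ioi

variable {d : ℕ} {α : Fin d → ℝ}

theorem ae_mem_orthant (α : Fin d → ℝ) : ∀ᵐ x ∂laguerreMeasure α, x ∈ orthant d :=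
  (withDensity_absolutelyContinuous _ _).ae_le (ae_restrict_mem (measurableSet_orthant d))

instance : SFinite (laguerreMeasure α) := by
  unfold laguerreMeasure
  infer_instance

theorem lintegral_heatKernel_le (hα : ∀ i, -1 < α i) {t : ℝ} (ht : 0 < t) {x : Fin d → ℝ}
    (hx : x ∈ orthant d) :
    ∫⁻ y, ENNReal.ofReal (heatKernel α t x y) ∂laguerreMeasure α ≤ 1 := by
  have hvol : volume.restrict (orthant d) =
      Measure.pi fun _ : Fin d => (volume : Measure ℝ).restrict (Ioi 0) := by
    rw [← Measure.restrict_pi_pi, ← volume_pi]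
    congr 1
    ext
    simp [orthant]
  have hΓ : ∀ i, 0 < Real.Gamma (α i + 1) := fun i => Real.Gamma_pos_of_pos (by linarith [hα i])
  have hnn : ∀ i, 0 ≤ᵐ[volume.restrict (Ioi (0 : ℝ))]
      fun y => heatKernel₁ (α i) t (x i) y * laguerreDensity₁ (α i) y := fun i => by
    filter_upwards [ae_restrict_mem measurableSet_Ioi] with y hy
    have hy : 0 < y := hy
    have := hΓ i
    exact mul_nonneg (heatKernel₁_nonneg (hα i) ht) (by unfold laguerreDensity₁; positivity)
  have hlt := fun i => lintegral_heatKernel₁_mul_density_le (hα i) ht (hx i)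
  have hint : ∀ i, Integrable (fun y => heatKernel₁ (α i) t (x i) y * laguerreDensity₁ (α i) y)
      (volume.restrict (Ioi (0 : ℝ))) := fun i => by
    refine ⟨(((measurable_heatKernel₁_uncurry (α i) (x i)).comp
      measurable_prodMk_left).mul
      (by unfold laguerreDensity₁; fun_prop)).aestronglyMeasurable, ?_⟩
    rw [hasFiniteIntegral_iff_ofReal (hnn i)]
    exact (hlt i).trans_lt ENNReal.one_lt_top
  unfold laguerreMeasure
  refine (lintegral_withDensity_le_lintegral_mul _ (by fun_prop) _).trans ?_
  calc _ = ∫⁻ y in orthant d, ENNReal.ofReal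
        (∏ i, heatKernel₁ (α i) t (x i) (y i) * laguerreDensity₁ (α i) (y i)) := by
        refine setLIntegral_congr_fun (measurableSet_orthant d) fun y hy => ?_
        have hK : 0 ≤ heatKernel α t x y :=
          Finset.prod_nonneg fun i _ => heatKernel₁_nonneg (hα i) ht
        rw [Pi.mul_apply, ← ENNReal.ofReal_mul' hK, Finset.prod_mul_distrib, mul_comm]
        rfl
    _ = ENNReal.ofReal (∏ i, ∫ y in Ioi (0 : ℝ),
          heatKernel₁ (α i) t (x i) y * laguerreDensity₁ (α i) y) := by
        rw [← integral_fintype_prod_eq_prod, ← ofReal_integral_eq_lintegral_ofReal, ← hvol]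
        · rw [hvol]
          exact Integrable.fintype_prod hint
        · filter_upwards [ae_restrict_mem (measurableSet_orthant d)] with y hy
          refine Finset.prod_nonneg fun i _ => mul_nonneg (heatKernel₁_nonneg (hα i) ht) ?_
          have := hΓ i
          have := hy i
          unfold laguerreDensity₁
          positivity
    _ ≤ 1 := by
        rw [ENNReal.ofReal_le_one]
        refine Finset.prod_le_one (fun i _ => integral_nonneg_of_ae (hnn i)) fun i _ => ?_
        rw [integral_eq_lintegral_of_nonneg_ae (hnn i) (hint i).1]
        exact ENNReal.toReal_le_of_le_ofReal zero_le_one (by simpa using hlt i)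

variable {𝕜 : Type*} [RCLike 𝕜]

/-- The heat semigroup contracts `L^∞`, pointwise on the orthant. -/
theorem norm_heatSemigroup_le (hα : ∀ i, -1 < α i) {t : ℝ} (ht : 0 < t) {x : Fin d → ℝ}
    (hx : x ∈ orthant d) {f : (Fin d → ℝ) → 𝕜} {M : ℝ} (hM : 0 ≤ M)
    (hf : ∀ᵐ y ∂laguerreMeasure α, ‖f y‖ ≤ M) : ‖heatSemigroup α t f x‖ ≤ M := by
  rw [heatSemigroup, if_pos ht]
  have h : ‖∫ y, heatKernel α t x y • f y ∂laguerreMeasure α‖ₑ ≤ ENNReal.ofReal M := by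
    calc _ ≤ ∫⁻ y, ‖heatKernel α t x y • f y‖ₑ ∂laguerreMeasure α :=
          enorm_integral_le_lintegral_enorm _
      _ ≤ ∫⁻ y, ENNReal.ofReal (heatKernel α t x y) * ENNReal.ofReal M ∂laguerreMeasure α := by
          refine lintegral_mono_ae ?_
          filter_upwards [hf] with y hy
          have hK : 0 ≤ heatKernel α t x y :=
            Finset.prod_nonneg fun i _ => heatKernel₁_nonneg (hα i) ht
          rw [enorm_smul, Real.enorm_eq_ofReal hK, ← ofReal_norm]
          gcongr
      _ ≤ 1 * ENNReal.ofReal M := by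
          rw [lintegral_mul_const' _ _ ENNReal.ofReal_ne_top]
          gcongr
          exact lintegral_heatKernel_le hα ht hx
      _ = _ := one_mul _
  rwa [← ofReal_norm, ENNReal.ofReal_le_ofReal_iff hM] at h

/-- `w ↦ T_{1/w} f(x)` is measurable; the reciprocal time is the variable of the subordination
integral after the substitution `u = t² w / 4`. -/
theorem aestronglyMeasurable_heatSemigroup_inv (α : Fin d → ℝ) (x : Fin d → ℝ)
    {f : (Fin d → ℝ) → 𝕜} (hf : StronglyMeasurable f) :
    AEStronglyMeasurable (fun w => heatSemigroup α w⁻¹ f x)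
      (volume.restrict (Ioi (0 : ℝ))) := by
  have hmeas : StronglyMeasurable fun p : ℝ × (Fin d → ℝ) =>
      heatKernel α p.1⁻¹ x p.2 • f p.2 := by
    refine StronglyMeasurable.smul (Measurable.stronglyMeasurable ?_)
      (hf.comp_measurable measurable_snd)
    exact Finset.measurable_fun_prod _ fun i _ =>
      (measurable_heatKernel₁_uncurry (α i) (x i)).comp
        (f := fun p : ℝ × (Fin d → ℝ) => (p.1⁻¹, p.2 i)) (by fun_prop)
  refine (hmeas.integral_prod_right' (ν := laguerreMeasure α)).aestronglyMeasurable.congr ?_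
  filter_upwards [ae_restrict_mem measurableSet_Ioi] with w hw
  rw [heatSemigroup, if_pos (inv_pos.2 hw)]

end Kernel

/-! ### Derivatives of Gauss-Laplace integrals -/

section GaussLaplace

variable {E : Type*} [NormedAddCommGroup E] [NormedSpace ℝ E]

/-- The integral `∫_0^∞ w^(j - 1/2) exp(-t² w / 4) g(w) dw`. -/
noncomputable def laplaceMoment (g : ℝ → E) (j : ℕ) (t : ℝ) : E :=
  ∫ w in Ioi (0 : ℝ), (w ^ ((j : ℝ) - 1 / 2) * Real.exp (-(t ^ 2 / 4 * w))) • g w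

theorem integrableOn_rpow_mul_exp (j : ℕ) {t : ℝ} (ht : 0 < t) :
    IntegrableOn (fun w : ℝ => w ^ ((j : ℝ) - 1 / 2) * Real.exp (-(t ^ 2 / 4 * w))) (Ioi 0) := by
  have hj : (-1 : ℝ) < (j : ℝ) - 1 / 2 := by have := j.cast_nonneg (α := ℝ); linarith
  have := integrableOn_rpow_mul_exp_neg_mul_rpow hj one_pos (b := t ^ 2 / 4) (by positivity)
  simpa [neg_mul] using this

variable {g : ℝ → E} {M : ℝ}

theorem norm_laplaceMoment_le (hM : ∀ w, 0 < w → ‖g w‖ ≤ M) (j : ℕ) {t : ℝ} (ht : 0 < t) :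
    ‖laplaceMoment g j t‖ ≤
      2 ^ (2 * (j : ℝ) + 1) * Real.Gamma ((j : ℝ) + 1 / 2) * M * t ^ (-(2 * (j : ℝ) + 1)) := by
  have h1 : ‖laplaceMoment g j t‖ ≤
      ∫ w in Ioi (0 : ℝ), w ^ ((j : ℝ) - 1 / 2) * Real.exp (-(t ^ 2 / 4 * w)) * M := by
    refine norm_integral_le_of_norm_le ((integrableOn_rpow_mul_exp j ht).mul_const M) ?_
    filter_upwards [ae_restrict_mem measurableSet_Ioi] with w hw
    have hw : 0 < w := hw
    rw [norm_smul, Real.norm_of_nonneg (by positivity)]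
    exact mul_le_mul_of_nonneg_left (hM w hw) (by positivity)
  refine h1.trans_eq ?_
  have h2 := Real.integral_rpow_mul_exp_neg_mul_Ioi (a := (j : ℝ) + 1 / 2) (r := t ^ 2 / 4)
    (by positivity) (by positivity)
  rw [show (j : ℝ) + 1 / 2 - 1 = j - 1 / 2 by ring] at h2
  rw [integral_mul_const, h2]
  have h3 : (1 / (t ^ 2 / 4)) ^ ((j : ℝ) + 1 / 2) =
      2 ^ (2 * (j : ℝ) + 1) * t ^ (-(2 * (j : ℝ) + 1)) := by
    rw [show 1 / (t ^ 2 / 4) = (2 * t⁻¹) ^ (2 : ℝ) by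
      rw [Real.rpow_two]; field_simp; norm_num, ← Real.rpow_mul (by positivity),
      show (2 : ℝ) * (j + 1 / 2) = 2 * j + 1 by ring,
      Real.mul_rpow (by positivity) (by positivity), Real.inv_rpow ht.le, Real.rpow_neg ht.le]
  rw [h3]; ring

theorem hasDerivAt_laplaceMoment (hg : AEStronglyMeasurable g (volume.restrict (Ioi 0)))
    (hM : ∀ w, 0 < w → ‖g w‖ ≤ M) (j : ℕ) {t : ℝ} (ht : 0 < t) :
    HasDerivAt (laplaceMoment g j) (-(t / 2) • laplaceMoment g (j + 1) t) t := by
  have hmeas : ∀ (j : ℕ) (s : ℝ), AEStronglyMeasurable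
      (fun w : ℝ => (w ^ ((j : ℝ) - 1 / 2) * Real.exp (-(s ^ 2 / 4 * w))) • g w)
      (volume.restrict (Ioi 0)) := fun j s =>
    AEStronglyMeasurable.smul (by measurability) hg
  have hint : Integrable (fun w : ℝ => (w ^ ((j : ℝ) - 1 / 2) *
      Real.exp (-(t ^ 2 / 4 * w))) • g w) (volume.restrict (Ioi 0)) := by
    refine ((integrableOn_rpow_mul_exp j ht).mul_const M).mono' (hmeas j t) ?_
    filter_upwards [ae_restrict_mem measurableSet_Ioi] with w hw
    have hw : 0 < w := hw
    rw [norm_smul, Real.norm_of_nonneg (by positivity)]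
    exact mul_le_mul_of_nonneg_left (hM w hw) (by positivity)
  have key := hasDerivAt_integral_of_dominated_loc_of_deriv_le
    (μ := volume.restrict (Ioi (0 : ℝ)))
    (F := fun s w => (w ^ ((j : ℝ) - 1 / 2) * Real.exp (-(s ^ 2 / 4 * w))) • g w)
    (F' := fun s w => -(s / 2) •
      (w ^ (((j + 1 : ℕ) : ℝ) - 1 / 2) * Real.exp (-(s ^ 2 / 4 * w))) • g w)
    (bound := fun w => t * (w ^ (((j + 1 : ℕ) : ℝ) - 1 / 2) *
      Real.exp (-((t / 2) ^ 2 / 4 * w)) * M))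
    -- on `(t / 2, 2 t)` the factor `s / 2` is at most `t` and the exponential is largest at `t / 2`
    (x₀ := t) (Ioo_mem_nhds (show t / 2 < t by linarith) (show t < 2 * t by linarith))
    (Eventually.of_forall fun s => hmeas j s) hint ((hmeas (j + 1) t).const_smul _) ?_
    (((integrableOn_rpow_mul_exp (j + 1) (half_pos ht)).mul_const M).const_mul t) ?_
  · have := key.2
    rw [integral_smul] at this
    exact this
  · filter_upwards [ae_restrict_mem measurableSet_Ioi] with w hw s hs
    have hw : 0 < w := hw
    have hs0 : 0 < s := by linarith [hs.1]
    rw [norm_smul, norm_smul, norm_neg, Real.norm_of_nonneg (by positivity),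
      Real.norm_of_nonneg (by positivity)]
    have hexp : Real.exp (-(s ^ 2 / 4 * w)) ≤ Real.exp (-((t / 2) ^ 2 / 4 * w)) := by
      have := hs.1
      gcongr
    have hM0 := hM w hw
    have : s / 2 ≤ t := by linarith [hs.2]
    gcongr
  · filter_upwards [ae_restrict_mem measurableSet_Ioi] with w hw s hs
    have hw : 0 < w := hw
    have h1 : HasDerivAt (fun s : ℝ => w ^ ((j : ℝ) - 1 / 2) * Real.exp (-(s ^ 2 / 4 * w)))
        (-(s / 2) * (w ^ (((j + 1 : ℕ) : ℝ) - 1 / 2) * Real.exp (-(s ^ 2 / 4 * w)))) s := by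
      have h2 : HasDerivAt (fun s : ℝ => -(s ^ 2 / 4 * w)) (-(s / 2) * w) s := by
        convert! ((((hasDerivAt_pow 2 s).div_const 4).mul_const w).fun_neg) using 1
        push_cast; ring
      convert! h2.exp.const_mul (w ^ ((j : ℝ) - 1 / 2)) using 1
      rw [show ((j + 1 : ℕ) : ℝ) - 1 / 2 = ((j : ℝ) - 1 / 2) + 1 by push_cast; ring,
        Real.rpow_add_one hw.ne']
      ring
    have h3 := h1.smul_const (g w)
    rwa [mul_smul] at h3

theorem hasDerivAt_pow_smul_laplaceMoment
    (hg : AEStronglyMeasurable g (volume.restrict (Ioi 0)))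
    (hM : ∀ w, 0 < w → ‖g w‖ ≤ M) (i j : ℕ) {t : ℝ} (ht : 0 < t) :
    HasDerivAt (fun s => s ^ i • laplaceMoment g j s)
      ((i : ℝ) • (t ^ (i - 1) • laplaceMoment g j t) +
        (-(1 / 2) : ℝ) • (t ^ (i + 1) • laplaceMoment g (j + 1) t)) t := by
  convert! (hasDerivAt_pow i t).fun_smul (hasDerivAt_laplaceMoment hg hM j ht) using 1
  rw [add_comm, smul_smul, smul_smul, smul_smul]
  congr 2
  ring

theorem contDiffOn_pow_smul_laplaceMoment
    (hg : AEStronglyMeasurable g (volume.restrict (Ioi 0)))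
    (hM : ∀ w, 0 < w → ‖g w‖ ≤ M) (n i j : ℕ) :
    ContDiffOn ℝ n (fun s => s ^ i • laplaceMoment g j s) (Ioi 0) := by
  induction n generalizing i j with
  | zero =>
    exact contDiffOn_zero.2 fun t ht =>
      (hasDerivAt_pow_smul_laplaceMoment hg hM i j ht).continuousAt.continuousWithinAt
  | succ n ih =>
    push_cast
    rw [contDiffOn_succ_iff_deriv_of_isOpen isOpen_Ioi]
    refine ⟨fun t ht => (hasDerivAt_pow_smul_laplaceMoment hg hM i j
      ht).differentiableAt.differentiableWithinAt, by simp, ?_⟩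
    refine ContDiffOn.congr (((ih (i - 1) j).const_smul (i : ℝ)).add
      ((ih (i + 1) (j + 1)).const_smul (-(1 / 2) : ℝ))) fun t ht => ?_
    exact (hasDerivAt_pow_smul_laplaceMoment hg hM i j ht).deriv

/-- Homogeneity: `t^i ∫ w^(j - 1/2) exp(-t² w / 4) g(w) dw` has degree `i - 2 j - 1` in `t` when `g`
is constant, and each derivative lowers this degree by one. The constant does not depend on `g`. -/
theorem exists_norm_iteratedDeriv_le (E : Type*) [NormedAddCommGroup E] [NormedSpace ℝ E]
    (n i j : ℕ) : ∃ C : ℝ, 0 ≤ C ∧ ∀ (g : ℝ → E) (M : ℝ),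
      AEStronglyMeasurable g (volume.restrict (Ioi 0)) → (∀ w, 0 < w → ‖g w‖ ≤ M) →
      ∀ t, 0 < t → ‖iteratedDeriv n (fun s => s ^ i • laplaceMoment g j s) t‖ ≤
        C * M * t ^ ((i : ℝ) - (2 * j + 1) - n) := by
  induction n generalizing i j with
  | zero =>
    refine ⟨2 ^ (2 * (j : ℝ) + 1) * Real.Gamma ((j : ℝ) + 1 / 2),
      mul_nonneg (by positivity) (Real.Gamma_pos_of_pos (by positivity)).le,
      fun g M hg hM t ht => ?_⟩
    rw [iteratedDeriv_zero, norm_smul, Real.norm_of_nonneg (by positivity), Nat.cast_zero,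
      sub_zero, sub_eq_add_neg, Real.rpow_add ht, Real.rpow_natCast]
    calc _ ≤ t ^ i * _ := mul_le_mul_of_nonneg_left (norm_laplaceMoment_le hM j ht) (by positivity)
      _ = _ := by ring
  | succ n ih =>
    obtain ⟨C₁, hC₁, h₁⟩ := ih (i - 1) j
    obtain ⟨C₂, hC₂, h₂⟩ := ih (i + 1) (j + 1)
    refine ⟨i * C₁ + 1 / 2 * C₂, by positivity, fun g M hg hM t ht => ?_⟩
    have hev : deriv (fun s => s ^ i • laplaceMoment g j s) =ᶠ[𝓝 t] fun s =>
        (i : ℝ) • (s ^ (i - 1) • laplaceMoment g j s) +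
        (-(1 / 2) : ℝ) • (s ^ (i + 1) • laplaceMoment g (j + 1) s) := by
      filter_upwards [Ioi_mem_nhds ht] with s hs
      exact (hasDerivAt_pow_smul_laplaceMoment hg hM i j hs).deriv
    have hc : ∀ i j, ContDiffAt ℝ n (fun s => s ^ i • laplaceMoment g j s) t := fun i j =>
      (contDiffOn_pow_smul_laplaceMoment hg hM n i j).contDiffAt (Ioi_mem_nhds ht)
    rw [iteratedDeriv_succ', hev.iteratedDeriv_eq,
      iteratedDeriv_fun_add ((hc _ _).const_smul _) ((hc _ _).const_smul _),
      iteratedDeriv_fun_const_smul_field, iteratedDeriv_fun_const_smul_field]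
    refine (norm_add_le _ _).trans ?_
    rw [norm_smul, norm_smul, add_mul, add_mul]
    refine add_le_add ?_ ?_
    · -- for `i = 0` the truncated exponent `i - 1` is harmless, since its coefficient vanishes
      rcases i with _ | i
      · simp
      · rw [Real.norm_of_nonneg (by positivity), mul_assoc, mul_assoc]
        refine mul_le_mul_of_nonneg_left ((h₁ g M hg hM t ht).trans_eq ?_) (by positivity)
        rw [mul_assoc]
        congr 3
        push_cast
        ring
    · rw [norm_neg, Real.norm_of_nonneg (by positivity), mul_assoc, mul_assoc]
      refine mul_le_mul_of_nonneg_left ((h₂ g M hg hM t ht).trans_eq ?_) (by positivity)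
      rw [mul_assoc]
      congr 3
      push_cast
      ring

end GaussLaplace

/-! ### Integrating bounds on derivatives from infinity -/

section Decay

variable {E : Type*} [NormedAddCommGroup E] [NormedSpace ℝ E]

theorem continuousOn_iteratedDeriv {φ : ℝ → E} {n : ℕ} (hφ : ContDiffOn ℝ n φ (Ioi 0)) :
    ContinuousOn (iteratedDeriv n φ) (Ioi 0) :=
  (hφ.continuousOn_iteratedDerivWithin le_rfl isOpen_Ioi.uniqueDiffOn).congr
    fun _ hu => (iteratedDerivWithin_of_isOpen isOpen_Ioi hu).symm

/-- A bound on the `(k + 1)`-st derivative is integrated over `[t, ∞)`, where the `k`-th derivative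
vanishes at infinity. -/
theorem norm_iteratedDeriv_le_of_succ {φ : ℝ → E} {k : ℕ} {β B : ℝ} [CompleteSpace E]
    (hφ : ContDiffOn ℝ (k + 1 : ℕ) φ (Ioi 0))
    (hlim : Tendsto (iteratedDeriv k φ) atTop (𝓝 0)) (hβ : β < k)
    (hB : ∀ t, 0 < t → ‖iteratedDeriv (k + 1) φ t‖ ≤ B * t ^ (-((k + 1 : ℕ) : ℝ) + β))
    {t : ℝ} (ht : 0 < t) :
    ‖iteratedDeriv k φ t‖ ≤ B / (k - β) * t ^ (-(k : ℝ) + β) := by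
  have hder : ∀ s ∈ Ici t, HasDerivAt (iteratedDeriv k φ) (iteratedDeriv (k + 1) φ s) s := by
    intro s hs
    rw [iteratedDeriv_succ]
    have hd := (hφ.differentiableOn_iteratedDerivWithin (m := k)
      (by exact_mod_cast k.lt_succ_self) isOpen_Ioi.uniqueDiffOn).congr
      fun u hu => (iteratedDerivWithin_of_isOpen isOpen_Ioi hu).symm
    exact (hd.differentiableAt (Ioi_mem_nhds (ht.trans_le hs))).hasDerivAt
  have hcont : ContinuousOn (iteratedDeriv (k + 1) φ) (Ici t) :=
    (continuousOn_iteratedDeriv hφ).mono fun s hs => ht.trans_le hs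
  have hexp : -((k + 1 : ℕ) : ℝ) + β < -1 := by push_cast; linarith
  have hbi : IntegrableOn (fun s : ℝ => B * s ^ (-((k + 1 : ℕ) : ℝ) + β)) (Ioi t) :=
    (integrableOn_Ioi_rpow_of_lt hexp ht).const_mul B
  have hle : ∀ᵐ s ∂volume.restrict (Ioi t),
      ‖iteratedDeriv (k + 1) φ s‖ ≤ B * s ^ (-((k + 1 : ℕ) : ℝ) + β) := by
    filter_upwards [ae_restrict_mem measurableSet_Ioi] with s hs
    exact hB s (ht.trans hs)
  have hi : IntegrableOn (iteratedDeriv (k + 1) φ) (Ioi t) :=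
    hbi.mono' ((hcont.mono Ioi_subset_Ici_self).aestronglyMeasurable measurableSet_Ioi) hle
  have hI := integral_Ioi_of_hasDerivAt_of_tendsto' hder hi hlim
  have hn := norm_integral_le_of_norm_le hbi hle
  rw [hI, zero_sub, norm_neg, integral_const_mul, integral_Ioi_rpow_of_lt hexp ht] at hn
  refine hn.trans_eq ?_
  rw [show -((k + 1 : ℕ) : ℝ) + β + 1 = -(k : ℝ) + β by push_cast; ring]
  have h1 : (k : ℝ) - β ≠ 0 := by linarith
  have h2 : -(k : ℝ) + β ≠ 0 := by linarith
  rw [show -(k : ℝ) + β = -(k - β) by ring]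
  field_simp

/-- Integrating a bound on the `(m + l)`-th derivative `l` times. The constant does not depend on `φ`,
so that the lemma applies uniformly in `x` to `t ↦ P_t f(x)`. -/
theorem exists_norm_iteratedDeriv_le_of_add [CompleteSpace E] {m : ℕ} {β : ℝ} (hβ : β < m) (l : ℕ)
    {B : ℝ} (hB0 : 0 ≤ B) :
    ∃ B' : ℝ, 0 ≤ B' ∧ ∀ φ : ℝ → E, (∀ n : ℕ, ContDiffOn ℝ n φ (Ioi 0)) →
      (∀ k, m ≤ k → Tendsto (iteratedDeriv k φ) atTop (𝓝 0)) →
      (∀ t, 0 < t → ‖iteratedDeriv (m + l) φ t‖ ≤ B * t ^ (-((m + l : ℕ) : ℝ) + β)) →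
      ∀ t, 0 < t → ‖iteratedDeriv m φ t‖ ≤ B' * t ^ (-(m : ℝ) + β) := by
  induction l generalizing B with
  | zero => exact ⟨B, hB0, fun φ _ _ h => h⟩
  | succ l ih =>
    have hml : β < (m + l : ℕ) := hβ.trans_le (by exact_mod_cast Nat.le_add_right m l)
    obtain ⟨B', hB', h⟩ := ih (B := B / ((m + l : ℕ) - β)) (div_nonneg hB0 (by linarith))
    exact ⟨B', hB', fun φ hφ hlim hb => h φ hφ hlim fun t ht =>
      norm_iteratedDeriv_le_of_succ (hφ _) (hlim _ (Nat.le_add_right m l)) hml hb ht⟩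

end Decay

/-! ### The Poisson semigroup and the Lipschitz spaces -/

section Poisson

variable {𝕜 : Type*} [RCLike 𝕜] {d : ℕ} {α : Fin d → ℝ}

/-- Subordination after the substitution `u = t² w / 4`. -/
theorem poissonSemigroup_eq (α : Fin d → ℝ) (f : (Fin d → ℝ) → 𝕜) (x : Fin d → ℝ) {t : ℝ}
    (ht : 0 < t) : poissonSemigroup α t f x = (1 / Real.sqrt Real.pi / 2) •
      (t ^ 1 • laplaceMoment (fun w => heatSemigroup α w⁻¹ f x) 0 t) := by
  have hb : 0 < t ^ 2 / 4 := by positivity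
  have h := integral_comp_mul_left_Ioi
    (fun u => (Real.exp (-u) / Real.sqrt u) • heatSemigroup α (t ^ 2 / (4 * u)) f x) 0 hb
  rw [mul_zero, eq_inv_smul_iff₀ hb.ne'] at h
  rw [poissonSemigroup, ← h, laplaceMoment, smul_smul, smul_smul, ← integral_smul, ← integral_smul]
  refine setIntegral_congr_fun measurableSet_Ioi fun w hw => ?_
  have hw : 0 < w := hw
  have e1 : t ^ 2 / (4 * (t ^ 2 / 4 * w)) = w⁻¹ := by field_simp
  have e2 : Real.sqrt (t ^ 2 / 4 * w) = t / 2 * Real.sqrt w := by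
    rw [Real.sqrt_mul hb.le, show t ^ 2 / 4 = (t / 2) ^ 2 by ring, Real.sqrt_sq (by positivity)]
  have e3 : w ^ (((0 : ℕ) : ℝ) - 1 / 2) = (Real.sqrt w)⁻¹ := by
    rw [Real.sqrt_eq_rpow, ← Real.rpow_neg hw.le]
    norm_num
  simp only [e1, e2, e3, smul_smul]
  congr 1
  have := Real.sqrt_pos.2 hw
  field_simp
  ring

theorem iteratedDeriv_poissonSemigroup (α : Fin d → ℝ) (f : (Fin d → ℝ) → 𝕜) (x : Fin d → ℝ)
    (n : ℕ) {t : ℝ} (ht : 0 < t) :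
    iteratedDeriv n (fun s => poissonSemigroup α s f x) t = (1 / Real.sqrt Real.pi / 2) •
      iteratedDeriv n
        (fun s => s ^ 1 • laplaceMoment (fun w => heatSemigroup α w⁻¹ f x) 0 s) t := by
  rw [← iteratedDeriv_fun_const_smul_field]
  refine Filter.EventuallyEq.iteratedDeriv_eq n ?_
  filter_upwards [Ioi_mem_nhds ht] with s hs using poissonSemigroup_eq α f x hs

theorem contDiffOn_poissonSemigroup (hα : ∀ i, -1 < α i) {x : Fin d → ℝ} (hx : x ∈ orthant d)
    {f : (Fin d → ℝ) → 𝕜} (hf : StronglyMeasurable f) {M : ℝ} (hM : 0 ≤ M)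
    (hfM : ∀ᵐ y ∂laguerreMeasure α, ‖f y‖ ≤ M) (n : ℕ) :
    ContDiffOn ℝ n (fun s => poissonSemigroup α s f x) (Ioi 0) := by
  refine ContDiffOn.congr (ContDiffOn.const_smul (1 / Real.sqrt Real.pi / 2 : ℝ)
    (contDiffOn_pow_smul_laplaceMoment (aestronglyMeasurable_heatSemigroup_inv α x hf)
      (fun w hw => norm_heatSemigroup_le hα (inv_pos.2 hw) hx hM hfM) n 1 0))
    fun t ht => poissonSemigroup_eq α f x ht

/-- The basic smoothing estimate `‖∂ⁿ P_t f‖ ≤ C t^(-n) ‖f‖_∞`, pointwise on the orthant. -/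
theorem exists_norm_iteratedDeriv_poissonSemigroup_le (𝕜 : Type*) [RCLike 𝕜]
    (hα : ∀ i, -1 < α i) (n : ℕ) : ∃ C : ℝ, 0 ≤ C ∧ ∀ (x : Fin d → ℝ), x ∈ orthant d →
      ∀ (f : (Fin d → ℝ) → 𝕜) (M : ℝ), StronglyMeasurable f → 0 ≤ M →
      (∀ᵐ y ∂laguerreMeasure α, ‖f y‖ ≤ M) → ∀ t, 0 < t →
      ‖iteratedDeriv n (fun s => poissonSemigroup α s f x) t‖ ≤ C * M * t ^ (-(n : ℝ)) := by
  obtain ⟨C, hC, h⟩ := exists_norm_iteratedDeriv_le 𝕜 n 1 0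
  refine ⟨1 / Real.sqrt Real.pi / 2 * C, by positivity, fun x hx f M hf hM hfM t ht => ?_⟩
  rw [iteratedDeriv_poissonSemigroup α f x n ht, norm_smul, Real.norm_of_nonneg (by positivity),
    mul_assoc, mul_assoc]
  refine mul_le_mul_of_nonneg_left ((h _ M (aestronglyMeasurable_heatSemigroup_inv α x hf)
    (fun w hw => norm_heatSemigroup_le hα (inv_pos.2 hw) hx hM hfM) t ht).trans_eq ?_)
    (by positivity)
  rw [mul_assoc]
  congr 3
  norm_num

/-- The null sets of the essential suprema, one for each `t`, are merged by continuity in `t`. -/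
theorem ae_forall_norm_le_of_forall_eLpNorm_le {Ω E : Type*} [MeasurableSpace Ω]
    [NormedAddCommGroup E] {μ : Measure Ω} {ψ : Ω → ℝ → E} {b : ℝ → ℝ}
    (hψ : ∀ᵐ x ∂μ, ContinuousOn (ψ x) (Ioi 0)) (hb : ContinuousOn b (Ioi 0))
    (hb0 : ∀ t, 0 < t → 0 ≤ b t)
    (h : ∀ t, 0 < t → eLpNorm (fun x => ψ x t) ∞ μ ≤ ENNReal.ofReal (b t)) :
    ∀ᵐ x ∂μ, ∀ t, 0 < t → ‖ψ x t‖ ≤ b t := by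
  have hq : ∀ᵐ x ∂μ, ∀ q : ℚ, 0 < (q : ℝ) → ‖ψ x q‖ ≤ b q := by
    refine ae_all_iff.2 fun q => ?_
    by_cases hq : 0 < (q : ℝ)
    · have hle := h q hq
      rw [eLpNorm_exponent_top] at hle
      filter_upwards [enorm_ae_le_eLpNormEssSup (fun x => ψ x q) μ] with x hx _
      have := hx.trans hle
      rwa [← ofReal_norm, ENNReal.ofReal_le_ofReal_iff (hb0 q hq)] at this
    · exact Eventually.of_forall fun x h' => absurd h' hq
  filter_upwards [hψ, hq] with x hx hxq t ht
  have ht' : t ∈ closure (Ioi (0 : ℝ) ∩ range ((↑) : ℚ → ℝ)) :=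
    Rat.denseRange_cast.open_subset_closure_inter isOpen_Ioi ht
  refine ContinuousWithinAt.closure_le ht'
    ((hx.norm t ht).mono inter_subset_left) ((hb t ht).mono inter_subset_left) ?_
  rintro _ ⟨hs, q, rfl⟩
  exact hxq q hs

/-- For `t ≤ 1` a faster decay rate is the stronger one; for `t ≥ 1` the smoothing estimate takes
over. -/
theorem le_mul_rpow_of_le_of_le {v A D n β₁ β₂ t : ℝ} (hA : 0 ≤ A) (hD : 0 ≤ D) (hβ₁ : 0 ≤ β₁)
    (hβ : β₁ ≤ β₂) (ht : 0 < t) (h₁ : v ≤ A * t ^ (-n + β₂)) (h₂ : v ≤ D * t ^ (-n)) :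
    v ≤ (A + D) * t ^ (-n + β₁) := by
  have hp : 0 ≤ t ^ (-n + β₁) := (Real.rpow_pos_of_pos ht _).le
  rcases le_total t 1 with h | h
  · have := Real.rpow_le_rpow_of_exponent_ge ht h (show -n + β₁ ≤ -n + β₂ by linarith)
    nlinarith [mul_le_mul_of_nonneg_left this hA, mul_nonneg hD hp]
  · have := Real.rpow_le_rpow_of_exponent_le h (show -n ≤ -n + β₁ by linarith)
    nlinarith [mul_le_mul_of_nonneg_left this hD, mul_nonneg hA hp]

end Poisson

end Laguerre

open Laguerre Set Filter Topology in
theorem proposition3p2 {𝕜 : Type*} [RCLike 𝕜] {d : ℕ} (α : Fin d → ℝ)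
    (hα : ∀ i, -(1 / 2 : ℝ) < α i) (β₁ β₂ : ℝ) (hβ₁ : 0 < β₁) (hβ : β₁ < β₂) :
    Laguerre.Lip 𝕜 α β₂ ⊆ Laguerre.Lip 𝕜 α β₁ := by
  rintro f ⟨A, hA⟩
  have hα' : ∀ i, -1 < α i := fun i => by linarith [hα i]
  have hfm : StronglyMeasurable (f : (Fin d → ℝ) → 𝕜) := Lp.stronglyMeasurable f
  have hfM : ∀ᵐ y ∂laguerreMeasure α, ‖f y‖ ≤ ‖f‖ := by
    have hfin : eLpNorm f ∞ (laguerreMeasure α) ≠ ∞ := Lp.eLpNorm_ne_top f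
    filter_upwards [enorm_ae_le_eLpNormEssSup f (laguerreMeasure α)] with y hy
    rw [← eLpNorm_exponent_top] at hy
    rw [Lp.norm_def, ← toReal_enorm]
    exact ENNReal.toReal_mono hfin hy
  have hsmooth : ∀ x ∈ orthant d, ∀ n : ℕ,
      ContDiffOn ℝ n (fun s => poissonSemigroup α s f x) (Ioi 0) := fun x hx n =>
    contDiffOn_poissonSemigroup hα' hx hfm (norm_nonneg f) hfM n
  have hlt : β₁ < order β₁ := (order_isLeast hβ₁.le).1
  obtain ⟨l, hl⟩ : ∃ l, order β₂ = order β₁ + l := Nat.exists_eq_add_of_le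
    ((order_isLeast hβ₁.le).2 (hβ.trans (order_isLeast (hβ₁.trans hβ).le).1))
  obtain ⟨C, hC0, hC⟩ := exists_norm_iteratedDeriv_poissonSemigroup_le 𝕜 hα' (order β₂)
  obtain ⟨B, hB0, hB⟩ := exists_norm_iteratedDeriv_le_of_add (E := 𝕜) hlt l
    (B := A + C * ‖f‖) (by positivity)
  refine ⟨⟨B, hB0⟩, fun t ht => ?_⟩
  rw [eLpNorm_exponent_top]
  refine eLpNormEssSup_le_of_ae_bound ?_
  have hbound := ae_forall_norm_le_of_forall_eLpNorm_le
    (ψ := fun x t => iteratedDeriv (order β₂) (fun s => poissonSemigroup α s f x) t)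
    (b := fun t => A * t ^ (-(order β₂ : ℝ) + β₂)) (μ := laguerreMeasure α)
    (by filter_upwards [ae_mem_orthant α] with x hx
        using continuousOn_iteratedDeriv (hsmooth x hx _))
    (fun s hs => (continuousAt_const.mul
      (Real.continuousAt_rpow_const _ _ (Or.inl (ne_of_gt hs)))).continuousWithinAt)
    (fun s hs => by positivity) hA
  filter_upwards [ae_mem_orthant α, hbound] with x hx hxb
  refine hB _ (hsmooth x hx) (fun k hk => ?_) (fun s hs => ?_) t ht
  · obtain ⟨D, -, hD⟩ := exists_norm_iteratedDeriv_poissonSemigroup_le 𝕜 hα' k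
    have hk0 : (0 : ℝ) < k := hβ₁.trans (hlt.trans_le (by exact_mod_cast hk))
    have hz := (tendsto_rpow_neg_atTop hk0).const_mul (D * ‖f‖)
    rw [mul_zero] at hz
    refine squeeze_zero_norm' ?_ hz
    filter_upwards [eventually_gt_atTop 0] with s hs
      using hD x hx f ‖f‖ hfm (norm_nonneg f) hfM s hs
  · rw [← hl]
    exact le_mul_rpow_of_le_of_le A.2 (by positivity) hβ₁.le hβ.le hs (hxb s hs)
      (hC x hx f ‖f‖ hfm (norm_nonneg f) hfM s hs)
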